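/- Let $E$ be a real Banach space with dual $E^*$ and bidual $E^{**}$, and let $f\colon E\to\,]-\infty,\infty]$ be proper (that is, not identically $+\infty$), convex and lower semicontinuous. For a real Banach space $X$ and $g\colon X\to[-\infty,\infty]$ let $g^*\colon X^*\to[-\infty,\infty]$, $g^*(x^*)=\sup_{x\in X}\,[\langle x,x^*\rangle-g(x)]$, be the Fenchel conjugate, and let $\partial g\colon X\rightrightarrows X^*$ be the subdifferential: $x^*\in\partial g(x)$ if and only if $g(x)+g^*(x^*)=\langle x,x^*\rangle$. For a multifunction $S\colon E\rightrightarrows E^*$ with graph $G(S)$ let $$\varphi_S(x,x^*)=\sup_{(s,s^*)\in G(S)}\big[\langle s,x^*\rangle+\langle x,s^*\rangle-\langle s,s^*\rangle\big]\qquad((x,x^*)\in E\times E^*)$$ be its Fitzpatrick function, and identify $(E\times E^*)^*$ with $E^*\times E^{**}$ by $\langle (x,x^*),(y^*,y^{**})\rangle=\langle x,y^*\rangle+\langle x^*,y^{**}\rangle$. The Fitzpatrick extension $S^{\mathbb F}\colon E^*\rightrightarrows E^{**}$ of $S$ is defined by: $y^{**}\in S^{\mathbb F}(y^*)$ if and only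 if ${\varphi_S}^*(y^*,y^{**})=\langle y^*,y^{**}\rangle$. Then $$(\partial f)^{\mathbb F}=\partial(f^*),$$ as multifunctions from $E^*$ to $E^{**}$. -/

import Mathlib

noncomputable section

namespace FitzExt

/-- The class of proper convex lower semicontinuous functions `X → ]-∞, ∞]`. -/
structure IsPCLSC {X : Type*} [NormedAddCommGroup X] [NormedSpace ℝ X] (f : X → EReal) :
    Prop where
  /-- `f` takes its values in `]-∞, ∞]`. -/
  ne_bot : ∀ x, f x ≠ ⊥
  /-- The effective domain is nonempty. -/
  proper : ∃ x, f x ≠ ⊤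
  convex : ∀ x y : X, ∀ a b : ℝ, 0 < a → 0 < b → a + b = 1 →
    f (a • x + b • y) ≤ (a : EReal) * f x + (b : EReal) * f y
  lsc : LowerSemicontinuous f

/-- The Fenchel conjugate `f^* : X^* → [-∞, ∞]`, `f^*(x^*) = sup_X [x^* - f]`. -/
def conj {X : Type*} [NormedAddCommGroup X] [NormedSpace ℝ X] (f : X → EReal) :
    StrongDual ℝ X → EReal :=
  fun x' => ⨆ x : X, ((x' x : ℝ) : EReal) - f x

/-- The subdifferential `∂f : X ⇉ X^*`: `x^* ∈ ∂f(x)` iff `f(x) + f^*(x^*) = ⟨x, x^*⟩`. -/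
def subdiff {X : Type*} [NormedAddCommGroup X] [NormedSpace ℝ X] (f : X → EReal) :
    X → Set (StrongDual ℝ X) :=
  fun x => {x' | f x + conj f x' = ((x' x : ℝ) : EReal)}

/-- The graph of a multifunction `S : X ⇉ Y`. -/
def graph {X Y : Type*} (S : X → Set Y) : Set (X × Y) :=
  {p | p.2 ∈ S p.1}

/-- The Fitzpatrick function of `S : E ⇉ E^*`,
`φ_S(x, x^*) = sup_{(s, s^*) ∈ G(S)} [⟨s, x^*⟩ + ⟨x, s^*⟩ - ⟨s, s^*⟩]`. -/
def fitzFun {E : Type*} [NormedAddCommGroup E] [NormedSpace ℝ E]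
    (S : E → Set (StrongDual ℝ E)) : E × StrongDual ℝ E → EReal :=
  fun p => ⨆ s ∈ graph S, ((p.2 s.1 + s.2 p.1 - s.2 s.1 : ℝ) : EReal)

/-- The Fitzpatrick extension `S^𝔽 : E^* ⇉ E^{**}`: `y^{**} ∈ S^𝔽(y^*)` iff
`φ_S^*(y^*, y^{**}) = ⟨y^*, y^{**}⟩`. Here `(y^*, y^{**})` is read as the element
`(x, x^*) ↦ ⟨x, y^*⟩ + ⟨x^*, y^{**}⟩` of `(E × E^*)^*`, which is `y^*.coprod y^{**}`. -/
def fitzExt {E : Type*} [NormedAddCommGroup E] [NormedSpace ℝ E]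
    (S : E → Set (StrongDual ℝ E)) :
    StrongDual ℝ E → Set (StrongDual ℝ (StrongDual ℝ E)) :=
  fun y' => {y'' | conj (fitzFun S) (y'.coprod y'') = ((y'' y' : ℝ) : EReal)}

end FitzExt

end

open Filter Topology

namespace FitzExt

/-! By Fenchel–Young, `φ_{∂f} ≤ f ⊕ f^*`, so `φ_{∂f}^* ≥ f^* ⊕ f^{**}`. If `φ_{∂f}^*(y', y'') = ⟨y',
y''⟩`, Fenchel–Young for `f^*` must then be an equality at `(y', y'')`. Conversely, for `y'' ∈
∂(f^*)(y')`, the same bound leaves only `φ_{∂f}^*(y', y'') ≤ ⟨y', y''⟩` to prove, which is the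
density statement `exists_mem_graph_pairing_le`.

For that, move `y'` slightly towards `x'`, to `z' = y' + t(x' - y')`. The subgradient inequality for
`f^*` forces near-maximizers `u` of `z' - f` to satisfy `⟨u, x' - y'⟩ ≳ ⟨x' - y', y''⟩`. Ekeland's
principle, applied to `f - z'` plus a small multiple of `‖· - x‖²`, turns a near-maximizer into an
exact minimizer of a perturbed function, and the sum rule there yields the point of the graph of
`∂f`. -/

/-- Ekeland's variational principle for a closed set (typically an epigraph) in `X × ℝ`. -/
theorem exists_ekeland_point {X : Type*} [MetricSpace X] [CompleteSpace X] {C : Set (X × ℝ)}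
    (hC : IsClosed C) {m : ℝ} (hm : ∀ p ∈ C, m ≤ p.2) {l : ℝ} (hl : 0 < l)
    {p₀ : X × ℝ} (hp₀ : p₀ ∈ C) :
    ∃ p ∈ C, p.2 ≤ p₀.2 ∧ ∀ q ∈ C, p.2 ≤ q.2 + l * dist q.1 p.1 := by
  have step : ∀ (n : ℕ) (v : C), ∃ p : C, p.1.2 + l * dist p.1.1 v.1.1 ≤ v.1.2 ∧
      ∀ q ∈ C, q.2 + l * dist q.1 v.1.1 ≤ v.1.2 → p.1.2 ≤ q.2 + (1 / 2 : ℝ) ^ n := by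
    intro n v
    let S : Set ℝ := {r | ∃ q ∈ C, q.2 + l * dist q.1 v.1.1 ≤ v.1.2 ∧ q.2 = r}
    have hne : S.Nonempty := ⟨v.1.2, v.1, v.2, by simp, rfl⟩
    have hbdd : BddBelow S := ⟨m, by rintro r ⟨q, hq, -, rfl⟩; exact hm q hq⟩
    obtain ⟨_, ⟨p, hpC, hpv, rfl⟩, hp⟩ := exists_lt_of_csInf_lt hne
      (lt_add_of_pos_right (sInf S) (by positivity : (0 : ℝ) < (1 / 2 : ℝ) ^ n))
    refine ⟨⟨p, hpC⟩, hpv, fun q hq hqv => ?_⟩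
    have : sInf S ≤ q.2 := csInf_le hbdd ⟨q, hq, hqv, rfl⟩
    dsimp only
    linarith
  choose next hnext hinf using step
  let p : ℕ → C := fun n => Nat.rec ⟨p₀, hp₀⟩ next n
  have hp_succ : ∀ n, p (n + 1) = next n (p n) := fun _ => rfl
  have hchain : ∀ n k, (p (n + k)).1.2 + l * dist (p (n + k)).1.1 (p n).1.1 ≤ (p n).1.2 := by
    intro n k
    induction k with
    | zero => simp
    | succ k ih =>
      have h := hnext (n + k) (p (n + k))
      rw [← hp_succ] at h
      have tri := mul_le_mul_of_nonneg_left
        (dist_triangle (p (n + (k + 1))).1.1 (p (n + k)).1.1 (p n).1.1) hl.le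
      rw [← add_assoc] at tri ⊢
      linarith
  have hchain' : ∀ n k, n ≤ k →
      (p k).1.2 + l * dist (p k).1.1 (p n).1.1 ≤ (p n).1.2 := by
    intro n k hnk
    obtain ⟨j, rfl⟩ := Nat.exists_eq_add_of_le hnk
    exact hchain n j
  have hanti : Antitone fun n => (p n).1.2 := fun n k hnk => by
    have := hchain' n k hnk
    have : 0 ≤ l * dist (p k).1.1 (p n).1.1 := by positivity
    dsimp only
    linarith
  have hbdd : BddBelow (Set.range fun n => (p n).1.2) :=
    ⟨m, by rintro _ ⟨n, rfl⟩; exact hm _ (p n).2⟩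
  have hlim := tendsto_atTop_ciInf hanti hbdd
  set L := ⨅ n, (p n).1.2
  have hcauchy : CauchySeq fun n => (p n).1.1 := by
    refine cauchySeq_of_le_tendsto_0' (fun n => ((p n).1.2 - L) / l) (fun n k hnk => ?_) ?_
    · rw [le_div_iff₀ hl, dist_comm]
      have h1 := hchain' n k hnk
      have h2 : L ≤ (p k).1.2 := ciInf_le hbdd k
      linarith
    · simpa using (hlim.sub_const L).div_const l
  obtain ⟨s, hs⟩ := cauchySeq_tendsto_of_complete hcauchy
  have hmem : (s, L) ∈ C :=
    hC.mem_of_tendsto (hs.prodMk_nhds hlim) (Eventually.of_forall fun n => (p n).2)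
  have hle : ∀ n, L + l * dist s (p n).1.1 ≤ (p n).1.2 := fun n =>
    le_of_tendsto (hlim.add ((hs.dist tendsto_const_nhds).const_mul l))
      ((eventually_ge_atTop n).mono fun k hk => hchain' n k hk)
  refine ⟨(s, L), hmem, ciInf_le hbdd 0, fun q hq => ?_⟩
  by_contra! hlt
  -- A point `q` violating the conclusion at the limit is admissible at every stage, so no stage can
  -- undercut it by more than `(1 / 2) ^ n`.
  have hLq : L ≤ q.2 := by
    have hpow : Tendsto (fun n : ℕ => q.2 + (1 / 2 : ℝ) ^ n) atTop (𝓝 (q.2 + 0)) :=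
      (tendsto_pow_atTop_nhds_zero_of_lt_one (by norm_num) (by norm_num)).const_add _
    rw [add_zero] at hpow
    refine ge_of_tendsto' hpow fun n => ?_
    refine (ciInf_le hbdd (n + 1)).trans (hinf n (p n) q hq ?_)
    have tri := mul_le_mul_of_nonneg_left (dist_triangle q.1 s (p n).1.1) hl.le
    have := hle n
    dsimp only at hlt
    linarith
  have : 0 ≤ l * dist q.1 s := by positivity
  dsimp only at hlt
  linarith

/-! ### Epigraphs, conjugates and subgradients -/

section

variable {E : Type*} [NormedAddCommGroup E] [NormedSpace ℝ E] {f : E → EReal}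

theorem IsPCLSC.convex_epigraph (hf : IsPCLSC f) :
    Convex ℝ {p : E × ℝ | f p.1 ≤ (p.2 : EReal)} := by
  rw [convex_iff_forall_pos]
  rintro ⟨u, r⟩ hu ⟨v, q⟩ hv a b ha hb hab
  simp only [Set.mem_ofPred_eq] at hu hv
  refine (hf.convex u v a b ha hb hab).trans ?_
  have h1 : (a : EReal) * f u ≤ (a : EReal) * r :=
    mul_le_mul_of_nonneg_left hu (by exact_mod_cast ha.le)
  have h2 : (b : EReal) * f v ≤ (b : EReal) * q :=
    mul_le_mul_of_nonneg_left hv (by exact_mod_cast hb.le)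
  refine (add_le_add h1 h2).trans (le_of_eq ?_)
  simp only [Prod.snd_add, Prod.smul_snd, smul_eq_mul]
  push_cast
  rfl

/-- This is the epigraph of `f + k`; moving `k` to the real side avoids addition in `EReal`. -/
theorem IsPCLSC.isClosed_epigraph_add (hf : IsPCLSC f) {k : E → ℝ} (hk : Continuous k) :
    IsClosed {p : E × ℝ | f p.1 ≤ ((p.2 - k p.1 : ℝ) : EReal)} := by
  have hcont : Continuous fun p : E × ℝ => (p.1, ((p.2 - k p.1 : ℝ) : EReal)) :=
    continuous_fst.prodMk (continuous_coe_real_ereal.comp (by fun_prop))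
  exact hf.lsc.isClosed_epigraph.preimage hcont

theorem coe_sub_le_conj (x' : StrongDual ℝ E) {u : E} {r : ℝ} (hu : f u ≤ r) :
    ((x' u - r : ℝ) : EReal) ≤ conj f x' := by
  refine le_trans ?_ (le_iSup (fun x : E => ((x' x : ℝ) : EReal) - f x) u)
  rw [EReal.coe_sub]
  exact EReal.sub_le_sub le_rfl hu

theorem le_of_conj_le {x' : StrongDual ℝ E} {c : ℝ} (h : conj f x' ≤ c) {u : E} {r : ℝ}
    (hu : f u ≤ r) : x' u - r ≤ c := by
  exact_mod_cast (coe_sub_le_conj x' hu).trans h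

theorem conj_le_of_forall_le (hbot : ∀ x, f x ≠ ⊥) {x' : StrongDual ℝ E} {c : ℝ}
    (h : ∀ u : E, ∀ r : ℝ, f u ≤ r → x' u - r ≤ c) : conj f x' ≤ c := by
  refine iSup_le fun u => ?_
  induction hu : f u with
  | bot => exact absurd hu (hbot u)
  | top => simp
  | coe r => exact_mod_cast h u r hu.le

theorem IsPCLSC.conj_ne_bot (hf : IsPCLSC f) (x' : StrongDual ℝ E) : conj f x' ≠ ⊥ := by
  obtain ⟨u, hu⟩ := hf.proper
  exact ne_bot_of_le_ne_bot (EReal.coe_ne_bot _)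
    (coe_sub_le_conj x' (EReal.coe_toReal hu (hf.ne_bot u)).ge)

theorem exists_coe_of_add_eq_coe {a b : EReal} {r : ℝ} (h : a + b = r) :
    ∃ a' b' : ℝ, a = a' ∧ b = b' ∧ a' + b' = r := by
  induction a with
  | bot => simp at h
  | top =>
    induction b with
    | bot => simp at h
    | top => simp at h
    | coe b => simp at h
  | coe a =>
    induction b with
    | bot => simp at h
    | top => simp at h
    | coe b => exact ⟨a, b, rfl, rfl, by exact_mod_cast h⟩

/-- A subgradient inequality puts a pair into the subdifferential. -/
theorem mem_subdiff_of_forall_le {s : E} {s' : StrongDual ℝ E} {a : ℝ} (hs : f s = a)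
    (h : ∀ u : E, ∀ r : ℝ, f u ≤ r → a + s' (u - s) ≤ r) (hbot : ∀ x, f x ≠ ⊥) :
    s' ∈ subdiff f s := by
  have hc : conj f s' = ((s' s - a : ℝ) : EReal) := by
    refine le_antisymm (conj_le_of_forall_le hbot fun u r hu => ?_) (coe_sub_le_conj s' hs.le)
    have := h u r hu
    rw [map_sub] at this
    linarith
  change f s + conj f s' = _
  rw [hs, hc, ← EReal.coe_add]
  congr 1
  ring

/-- If `s` minimizes `f + g`, with `g` continuous and convex, then some `s' ∈ ∂f(s)` has
`-s' ∈ ∂g(s)`. -/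
theorem IsPCLSC.exists_mem_subdiff_of_minimizer (hf : IsPCLSC f) {g : E → ℝ} (hg : Continuous g)
    (hgc : ConvexOn ℝ Set.univ g) {s : E} {a : ℝ} (hs : f s = a)
    (hmin : ∀ u : E, ∀ r : ℝ, f u ≤ r → a + g s ≤ r + g u) :
    ∃ s' ∈ subdiff f s, ∀ u, g s - s' (u - s) ≤ g u := by
  -- The strict hypograph of the concave function `a + g s - g`. It is open because `g` is
  -- continuous, and minimality keeps it off the epigraph of `f`; both sets touch `(s, a)`, so the
  -- separating hyperplane passes through that point.
  let A : Set (E × ℝ) := {p | p.2 + g p.1 < a + g s}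
  have hA : IsOpen A := isOpen_lt (by fun_prop) continuous_const
  have hAc : Convex ℝ A := by
    have hg' : ConvexOn ℝ Set.univ fun p : E × ℝ => p.2 + g p.1 := by
      refine ⟨convex_univ, fun p _ q _ α β hα hβ hαβ => ?_⟩
      have := hgc.2 (Set.mem_univ p.1) (Set.mem_univ q.1) hα hβ hαβ
      simp only [Prod.snd_add, Prod.fst_add, Prod.smul_fst, Prod.smul_snd, smul_eq_mul] at this ⊢
      linarith
    simpa [A] using hg'.convex_lt (a + g s)
  have hdisj : Disjoint A {p : E × ℝ | f p.1 ≤ (p.2 : EReal)} := by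
    rw [Set.disjoint_left]
    rintro ⟨u, r⟩ hp hq
    exact (hmin u r hq).not_gt hp
  obtain ⟨F, c, hFA, hFB⟩ := geometric_hahn_banach_open hAc hA hf.convex_epigraph hdisj
  let F₁ : StrongDual ℝ E := F.comp (ContinuousLinearMap.inl ℝ E ℝ)
  set β : ℝ := F (0, 1)
  have hF : ∀ u r, F (u, r) = F₁ u + β * r := by
    intro u r
    have : ((u, r) : E × ℝ) = (u, 0) + r • ((0, 1) : E × ℝ) := by simp
    rw [this, map_add, map_smul, smul_eq_mul, mul_comm]
    rfl
  have hB : ∀ u : E, ∀ r : ℝ, f u ≤ r → c ≤ F₁ u + β * r := fun u r h => by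
    rw [← hF]; exact hFB (u, r) h
  have hA' : ∀ u : E, F₁ u + β * (a + g s - g u) ≤ c := by
    intro u
    have hlim : Tendsto (fun r : ℝ => F₁ u + β * r) (𝓝[<] (a + g s - g u))
        (𝓝 (F₁ u + β * (a + g s - g u))) :=
      (Continuous.tendsto (by fun_prop) _).mono_left nhdsWithin_le_nhds
    refine le_of_tendsto hlim ?_
    filter_upwards [self_mem_nhdsWithin] with r hr
    rw [← hF]
    refine (hFA (u, r) ?_).le
    simp only [Set.mem_Iio] at hr
    simp only [A, Set.mem_ofPred_eq]
    linarith
  have hβ : 0 < β := by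
    have h1 : F₁ s + β * (a - 1) < c := by
      rw [← hF]
      refine hFA _ ?_
      simp only [A, Set.mem_ofPred_eq]
      linarith
    have h2 := hB s a hs.le
    linarith
  have hc : c = F₁ s + β * a := le_antisymm (hB s a hs.le) (by simpa using hA' s)
  have hdiv : ∀ u, β * ((-β⁻¹ • F₁) u) = - F₁ u := fun u => by
    simp only [smul_apply, smul_eq_mul]
    field_simp
  refine ⟨-β⁻¹ • F₁, mem_subdiff_of_forall_le hs (fun u r hu => ?_) hf.ne_bot, fun u => ?_⟩
  · have h1 := hB u r hu
    refine le_of_mul_le_mul_left ?_ hβ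
    rw [mul_add, hdiv, map_sub]
    linarith
  · have h1 := hA' u
    refine le_of_mul_le_mul_left ?_ hβ
    rw [mul_sub, hdiv, map_sub]
    linarith

/-! ### Approximation by the graph of `∂f` -/

/-- For `(y', y'')` in the graph of `∂(f^*)`, the infimum of `⟨x - s, x' - s'⟩` over the graph of `∂f` is
at most `⟨x - y'', x' - y'⟩`. -/
theorem IsPCLSC.exists_mem_graph_pairing_le [CompleteSpace E] (hf : IsPCLSC f)
    {y' : StrongDual ℝ E} {y'' : StrongDual ℝ (StrongDual ℝ E)} {α : ℝ} (hα : conj f y' = α)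
    (hy : ∀ u' : StrongDual ℝ E, ((α + y'' (u' - y') : ℝ) : EReal) ≤ conj f u')
    (x : E) (x' : StrongDual ℝ E) {ρ : ℝ} (hρ : 0 < ρ) :
    ∃ s s', s' ∈ subdiff f s ∧
      (x' - s') (x - s) ≤ (x' - y') x - y'' (x' - y') + ρ := by
  set w : StrongDual ℝ E := x' - y'
  set A : ℝ := w x - y'' w
  obtain ⟨t, ht0, ht1, htA⟩ : ∃ t : ℝ, 0 < t ∧ t ≤ 1 ∧ t * |A| ≤ ρ / 3 := by
    refine ⟨min 1 (ρ / 3 / (|A| + 1)), by positivity, min_le_left _ _, ?_⟩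
    calc min 1 (ρ / 3 / (|A| + 1)) * |A| ≤ ρ / 3 / (|A| + 1) * (|A| + 1) :=
          mul_le_mul (min_le_right _ _) (by linarith) (abs_nonneg _) (by positivity)
      _ = ρ / 3 := by field_simp
  -- Near-maximality of `u₀` and the quadratic term at `u₀` each cost `η`; dividing `2 * η` by `t`
  -- in `e4` leaves `ρ / 3`.
  set η : ℝ := t * ρ / 6
  have hη : 0 < η := by positivity
  set z' : StrongDual ℝ E := y' + t • w
  obtain ⟨u₀, r₀, hu₀, hr₀⟩ : ∃ (u₀ : E) (r₀ : ℝ), f u₀ ≤ r₀ ∧ α + t * y'' w - η ≤ z' u₀ - r₀ := by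
    have h1 : ((α + t * y'' w - η : ℝ) : EReal) < conj f z' := by
      refine lt_of_lt_of_le ?_ (hy z')
      have : y'' (z' - y') = t * y'' w := by simp [z']
      rw [this]
      exact_mod_cast sub_lt_self _ hη
    obtain ⟨u₀, hu₀⟩ := lt_iSup_iff.1 h1
    induction hfu : f u₀ with
    | bot => exact absurd hfu (hf.ne_bot u₀)
    | top => simp [hfu] at hu₀
    | coe r₀ =>
      rw [hfu] at hu₀
      exact ⟨u₀, r₀, hfu.le, by exact_mod_cast hu₀.le⟩
  set ε : ℝ := η / (1 + ‖u₀ - x‖ ^ 2)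
  have hε : 0 < ε := by positivity
  have hεu : ε * ‖u₀ - x‖ ^ 2 ≤ η := by
    have : ε * (1 + ‖u₀ - x‖ ^ 2) = η := by simp only [ε]; field_simp
    linarith
  set k : E → ℝ := fun u => ε * ‖u - x‖ ^ 2 - z' u
  have hk : Continuous k := by fun_prop
  -- Chosen so that `l * d - ε * d ^ 2` has maximum `l ^ 2 / (4 * ε) = ρ / 3`.
  set l : ℝ := √(4 * ε * (ρ / 3))
  have hl : 0 < l := by positivity
  have hl2 : l ^ 2 = 4 * ε * (ρ / 3) := Real.sq_sqrt (by positivity)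
  have hlow : ∀ u : E, ∀ r : ℝ, f u ≤ r → y' u - α ≤ r := fun u r hu => by
    linarith [le_of_conj_le hα.le hu]
  -- Since `f ≥ y' - α`, only the linear term `-t * w` can be unbounded below, and the quadratic
  -- term dominates it.
  have hbdd : ∀ p ∈ {p : E × ℝ | f p.1 ≤ ((p.2 - k p.1 : ℝ) : EReal)},
      -α - t * w x - (t * ‖w‖) ^ 2 / (4 * ε) ≤ p.2 := by
    rintro ⟨u, r⟩ hu
    have h1 := hlow u _ hu
    have h2 : w (u - x) ≤ ‖w‖ * ‖u - x‖ := (le_abs_self _).trans (w.le_opNorm _)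
    have h3 : t * w (u - x) ≤ t * (‖w‖ * ‖u - x‖) := mul_le_mul_of_nonneg_left h2 ht0.le
    have h4 : t * (‖w‖ * ‖u - x‖) ≤ ε * ‖u - x‖ ^ 2 + (t * ‖w‖) ^ 2 / (4 * ε) := by
      have h5 : 0 ≤ (2 * ε * ‖u - x‖ - t * ‖w‖) ^ 2 / (4 * ε) := by positivity
      have h6 : (2 * ε * ‖u - x‖ - t * ‖w‖) ^ 2 / (4 * ε) =
          ε * ‖u - x‖ ^ 2 + (t * ‖w‖) ^ 2 / (4 * ε) - t * (‖w‖ * ‖u - x‖) := by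
        field_simp
        ring
      linarith
    have h7 : z' u = y' u + t * w u := by simp [z']
    rw [map_sub, mul_sub] at h3
    simp only [k, h7] at h1 ⊢
    linarith
  have hepi : ∀ u : E, ∀ r : ℝ, f u ≤ r →
      (u, r + k u) ∈ {p : E × ℝ | f p.1 ≤ ((p.2 - k p.1 : ℝ) : EReal)} := fun u r hu => by
    simpa only [Set.mem_ofPred_eq, add_sub_cancel_right] using hu
  obtain ⟨⟨s, q⟩, hsq, hq, hek⟩ :=
    exists_ekeland_point (hf.isClosed_epigraph_add hk) hbdd hl (hepi u₀ r₀ hu₀)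
  have hsq' : f s ≤ ((q - k s : ℝ) : EReal) := hsq
  dsimp only at hq hek
  have hs : f s = ((q - k s : ℝ) : EReal) := by
    induction hfs : f s with
    | bot => exact absurd hfs (hf.ne_bot s)
    | top => rw [hfs] at hsq'; exact absurd hsq' (EReal.coe_lt_top _).not_ge
    | coe a =>
      rw [hfs] at hsq'
      have h1 : a ≤ q - k s := by exact_mod_cast hsq'
      have h2 := hek (s, a + k s) (hepi s a hfs.le)
      simp only [dist_self, mul_zero, add_zero] at h2
      congr 1
      linarith
  set g : E → ℝ := fun u => k u + l * ‖u - s‖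
  have hg : Continuous g := by fun_prop
  have hgc : ConvexOn ℝ Set.univ g := by
    have hn : ∀ v : E, ConvexOn ℝ Set.univ fun u : E => ‖u - v‖ := fun v => by
      simpa [sub_eq_add_neg, dist_eq_norm] using convexOn_univ_dist v
    have h1 : ConvexOn ℝ Set.univ fun u : E => ε * ‖u - x‖ ^ 2 := by
      simpa using ((hn x).pow (fun _ _ => norm_nonneg _) 2).smul hε.le
    have h2 : ConcaveOn ℝ Set.univ fun u : E => z' u := z'.toLinearMap.concaveOn convex_univ
    have h3 : ConvexOn ℝ Set.univ fun u : E => l * ‖u - s‖ := by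
      simpa using (hn s).smul hl.le
    exact (h1.sub h2).add h3
  obtain ⟨s', hs', hsub⟩ := hf.exists_mem_subdiff_of_minimizer hg hgc hs (by
    intro u r hu
    have := hek (u, r + k u) (hepi u r hu)
    simp only [dist_eq_norm] at this
    simp only [g, sub_self, norm_zero, mul_zero]
    linarith)
  refine ⟨s, s', hs', ?_⟩
  -- Testing at `x` bounds `(z' - s') (x - s)` by `ρ / 3`; the remainder `(1 - t) * w (x - s)` is
  -- controlled by `e4`.
  have e1 := hsub x
  have e2 := hlow s _ hs.le
  have hz : ∀ u, z' u = y' u + t * w u := fun u => by simp [z']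
  have hw : ∀ u, w u = x' u - y' u := fun u => by simp [w]
  simp only [g, k, sub_self, norm_zero, mul_zero, ne_eq, OfNat.ofNat_ne_zero, not_false_eq_true,
    zero_pow, map_sub, norm_sub_rev x s, hz] at e1
  simp only [k, hz] at e2 hq hr₀
  have e3 : l * ‖s - x‖ ≤ ε * ‖s - x‖ ^ 2 + ρ / 3 := by
    have h1 : 0 ≤ (2 * ε * ‖s - x‖ - l) ^ 2 := sq_nonneg _
    have h2 : 4 * ε * (l * ‖s - x‖) ≤ 4 * ε * (ε * ‖s - x‖ ^ 2 + ρ / 3) := by linarith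
    exact le_of_mul_le_mul_left h2 (by positivity)
  have e4 : y'' w - w s ≤ ρ / 3 := by
    refine le_of_mul_le_mul_left ?_ ht0
    have h1 : 0 ≤ ε * ‖s - x‖ ^ 2 := by positivity
    have h2 : 2 * η = t * (ρ / 3) := by simp only [η]; ring
    linarith
  have e5 : (1 - t) * (w x - w s) ≤ (1 - t) * (A + ρ / 3) :=
    mul_le_mul_of_nonneg_left (by simp only [A]; linarith) (by linarith)
  have e6 : -(t * A) ≤ ρ / 3 := by
    have := mul_le_mul_of_nonneg_left (neg_abs_le A) ht0.le
    linarith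
  have e7 : 0 ≤ t * (ρ / 3) := by positivity
  have e8 := hw x
  have e9 := hw s
  simp only [sub_apply, map_sub]
  linarith

/-! ### The two inclusions -/

theorem fitzFun_subdiff_le {x : E} {x' : StrongDual ℝ E} {r c : ℝ} (hr : f x ≤ r)
    (hc : conj f x' ≤ c) : fitzFun (subdiff f) (x, x') ≤ ((r + c : ℝ) : EReal) := by
  refine iSup₂_le fun ⟨s, s'⟩ hs => ?_
  obtain ⟨a, b, ha, hb, hab⟩ := exists_coe_of_add_eq_coe (show f s + conj f s' = (s' s : ℝ) from hs)
  have h1 := le_of_conj_le hc ha.le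
  have h2 := le_of_conj_le hb.le hr
  refine EReal.coe_le_coe_iff.2 ?_
  dsimp only
  linarith

theorem mem_subdiff_conj_of_mem_fitzExt (hf : IsPCLSC f) {y' : StrongDual ℝ E}
    {y'' : StrongDual ℝ (StrongDual ℝ E)} (h : y'' ∈ fitzExt (subdiff f) y') :
    y'' ∈ subdiff (conj f) y' := by
  have h : conj (fitzFun (subdiff f)) (y'.coprod y'') = ((y'' y' : ℝ) : EReal) := h
  set c : ℝ := y'' y'
  -- An empty graph would give `φ = ⊥`, hence `φ^* = ⊤`. A point of the graph supplies a finite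
  -- value of `f^*`, from which `key` makes `f^*(y')` finite.
  obtain ⟨⟨s, s'⟩, hs⟩ : (graph (subdiff f)).Nonempty := by
    by_contra hempty
    rw [Set.not_nonempty_iff_eq_empty] at hempty
    have h1 : ((y'.coprod y'') 0 : ℝ) - fitzFun (subdiff f) 0 ≤ (c : EReal) :=
      (le_iSup (fun p => (((y'.coprod y'') p : ℝ) : EReal) - fitzFun (subdiff f) p) 0).trans h.le
    simp [fitzFun, hempty] at h1
  obtain ⟨a, b, ha, hb, -⟩ := exists_coe_of_add_eq_coe (show f s + conj f s' = (s' s : ℝ) from hs)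
  have key : ∀ (u' : StrongDual ℝ E) (d : ℝ), conj f u' ≤ d →
      conj f y' ≤ ((c - y'' u' + d : ℝ) : EReal) := fun u' d hd =>
    conj_le_of_forall_le hf.ne_bot fun u r hu => by
      have h1 := le_of_conj_le h.le (fitzFun_subdiff_le hu hd)
      simp only [ContinuousLinearMap.coprod_apply] at h1
      linarith
  have htop : conj f y' ≠ ⊤ := ne_top_of_le_ne_top (EReal.coe_ne_top _) (key s' b hb.le)
  obtain ⟨α, hα⟩ : ∃ α : ℝ, conj f y' = α := ⟨_, (EReal.coe_toReal htop (hf.conj_ne_bot y')).symm⟩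
  have hconj : conj (conj f) y'' = ((c - α : ℝ) : EReal) := by
    refine le_antisymm (conj_le_of_forall_le hf.conj_ne_bot fun u' d hd => ?_)
      (coe_sub_le_conj y'' hα.le)
    have h1 := key u' d hd
    rw [hα, EReal.coe_le_coe_iff] at h1
    linarith
  change conj f y' + conj (conj f) y'' = (c : EReal)
  rw [hα, hconj, ← EReal.coe_add, add_sub_cancel]

theorem mem_fitzExt_of_mem_subdiff_conj [CompleteSpace E] (hf : IsPCLSC f) {y' : StrongDual ℝ E}
    {y'' : StrongDual ℝ (StrongDual ℝ E)} (h : y'' ∈ subdiff (conj f) y') :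
    y'' ∈ fitzExt (subdiff f) y' := by
  obtain ⟨α, γ, hα, hγ, hsum⟩ :=
    exists_coe_of_add_eq_coe (show conj f y' + conj (conj f) y'' = (y'' y' : ℝ) from h)
  have hy : ∀ u' : StrongDual ℝ E, ((α + y'' (u' - y') : ℝ) : EReal) ≤ conj f u' := fun u' => by
    refine EReal.le_of_forall_lt_iff_le.1 fun d hd => EReal.coe_le_coe_iff.2 ?_
    have h1 := le_of_conj_le hγ.le hd.le
    rw [map_sub]
    linarith
  change conj (fitzFun (subdiff f)) (y'.coprod y'') = ((y'' y' : ℝ) : EReal)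
  refine le_antisymm (iSup_le fun ⟨x, x'⟩ => ?_) ?_
  -- `φ(x, x')` is `⟨x, x'⟩` minus the infimum of `⟨x - s, x' - s'⟩` over the graph, so the density
  -- statement bounds it below.
  · have hle : ((y' x + y'' x' - y'' y' : ℝ) : EReal) ≤ fitzFun (subdiff f) (x, x') := by
      refine EReal.ge_of_forall_gt_iff_ge.1 fun r hr => ?_
      have hρ : 0 < y' x + y'' x' - y'' y' - r := sub_pos.2 (EReal.coe_lt_coe_iff.1 hr)
      obtain ⟨s, s', hs, hle⟩ := hf.exists_mem_graph_pairing_le hα hy x x' hρ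
      refine le_trans (EReal.coe_le_coe_iff.2 ?_)
        (le_iSup₂ (f := fun s (_ : s ∈ graph (subdiff f)) =>
          ((x' s.1 + s.2 x - s.2 s.1 : ℝ) : EReal)) (s, s') hs)
      simp only [sub_apply, map_sub] at hle
      dsimp only
      linarith
    refine (EReal.sub_le_sub le_rfl hle).trans ?_
    rw [← EReal.coe_sub, EReal.coe_le_coe_iff, ContinuousLinearMap.coprod_apply]
    linarith
  · refine EReal.le_of_forall_lt_iff_le.1 fun d hd => EReal.coe_le_coe_iff.2 ?_
    have h1 : conj f y' ≤ ((α - y'' y' + d : ℝ) : EReal) :=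
      conj_le_of_forall_le hf.ne_bot fun u r hu => by
        have h2 := le_of_conj_le hd.le (fitzFun_subdiff_le hu hα.le)
        simp only [ContinuousLinearMap.coprod_apply] at h2
        linarith
    rw [hα, EReal.coe_le_coe_iff] at h1
    linarith

end

end FitzExt

theorem mainTheorem5 {E : Type*} [NormedAddCommGroup E] [NormedSpace ℝ E] [CompleteSpace E]
    (f : E → EReal) (hf : FitzExt.IsPCLSC f) :
    FitzExt.fitzExt (FitzExt.subdiff f) = FitzExt.subdiff (FitzExt.conj f) := by
  funext y'
  ext y''
  exact ⟨FitzExt.mem_subdiff_conj_of_mem_fitzExt hf, FitzExt.mem_fitzExt_of_mem_subdiff_conj hf⟩
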